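/- All groups are finite. Let $C$ be a group of prime order and let $R$ be a commutative ring with identity. For a group $G$, a $C$-fibred $G$-set is a finite $(G\times C)$-set on which $C$ acts freely, and $RB_C^1(G)$ denotes the monomial Burnside group of $G$ with coefficients in $R$, i.e. the Grothendieck group of $C$-fibred $G$-sets with respect to disjoint union, tensored with $R$. Let $\mathcal P_{RB_C^1}$ be the $R$-linear category whose objects are the finite groups, whose morphisms from $G$ to $H$ are the elements of $RB_C^1(H\times G)$, and whose composition $\circ\colon RB_C^1(G\times H)\times RB_C^1(H\times K)\to RB_C^1(G\times K)$ is the $R$-bilinear map sending the classes of a $C$-fibred $(G\times H)$-set $T$ and a $C$-fibred $(H\times K)$-set $Y$ to the class of the set of those orbits of $T\times Y$ under the $(H\times C)$-action $$(h,c)(t,y)=\big((h,c)t,\,(h,c^{-1})y\big)$$ on which $C$ acts freely, where $G\times K\times C$ acts on orbits by $(g,k,c)[t,y]=[(g,c)t,\,ky]$; the identity of $G$ is the class of $(G\times G\times C)/\{(g,g,1)\mid g\in G\}$. An $RB_C^1$-module (a fibred biset functor) is an $R$-linear functor $S\colon\mathcal P_{RB_C^1}\to R\text{-}\mathrm{Mod}$;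 it is simple if it is nonzero and its only subfunctors are $0$ and $S$. A group $H$ is a minimal group for $S$ if $S(H)\neq 0$ and $S(K)=0$ for every group $K$ with $|K|<|H|$. Let $S$ be a simple $RB_C^1$-module. If $H$ and $K$ are two minimal groups for $S$, then $H$ and $K$ are isomorphic. -/

import Mathlib

open CategoryTheory

universe u v w

/-- A `C`-fibred `G`-set: a finite `(G × C)`-set on which `C` acts freely. -/
structure FibredSet (C G : Type u) [CommGroup C] [Group G] : Type (u + 1) where
  carrier : Type u
  [finite : Finite carrier]
  [action : MulAction (G × C) carrier]
  free : ∀ (c : C) (x : carrier), ((1 : G), c) • x = x → c = 1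

namespace FibredSet

instance instCoeSort {C G : Type u} [CommGroup C] [Group G] :
    CoeSort (FibredSet C G) (Type u) := ⟨FibredSet.carrier⟩

attribute [instance] FibredSet.finite FibredSet.action

/-- Isomorphism of `C`-fibred `G`-sets: an equivariant bijection. -/
def Iso {C G : Type u} [CommGroup C] [Group G] (X Y : FibredSet C G) : Prop :=
  ∃ e : X ≃ Y, ∀ (a : G × C) (x : X), e (a • x) = a • e x

/-- The disjoint union of two `C`-fibred `G`-sets. -/
def sum {C G : Type u} [CommGroup C] [Group G] (X Y : FibredSet C G) : FibredSet C G where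
  carrier := X ⊕ Y
  action :=
    { smul := fun a => Sum.map (a • ·) (a • ·)
      one_smul := by rintro (x | x) <;> simp [HSMul.hSMul, Sum.map] <;> exact one_smul _ x
      mul_smul := by
        rintro a b (x | x) <;> simp [HSMul.hSMul, Sum.map] <;> exact mul_smul a b x }
  free := by
    rintro c (x | x) h
    · exact X.free c x (Sum.inl.inj h)
    · exact Y.free c x (Sum.inr.inj h)

/-- The empty fibred set. -/
def empty (C G : Type u) [CommGroup C] [Group G] : FibredSet C G where
  carrier := PEmpty
  action :=
    { smul := fun _ x => x
      one_smul := fun _ => rfl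
      mul_smul := fun _ _ _ => rfl }
  free := fun _ x => x.elim

/-- The part `W_{C-f}` of a finite `(G × C)`-set `W`: the elements with trivial stabilizer in `C`,
a `C`-fibred `G`-set. -/
def freePart (C G : Type u) [CommGroup C] [Group G] (W : Type u) [Finite W]
    [MulAction (G × C) W] : FibredSet C G where
  carrier := {x : W // ∀ c : C, ((1 : G), c) • x = x → c = 1}
  action :=
    { smul := fun a x => ⟨a • x.1, fun c h => x.2 c (by
        have e : a * ((1 : G), c) = ((1 : G), c) * a := by
          ext <;> simp [mul_comm]
        have h2 : a • (((1 : G), c) • x.1) = a • x.1 := by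
          rw [smul_smul, e, ← smul_smul]
          exact h
        exact MulAction.injective a h2)⟩
      one_smul := fun x => Subtype.ext (one_smul _ x.1)
      mul_smul := fun a b x => Subtype.ext (mul_smul a b x.1) }
  free := fun c x h => x.2 c (congrArg Subtype.val h)

/-- The left inclusion into a disjoint union. -/
def inl {C G : Type u} [CommGroup C] [Group G] {X Y : FibredSet C G} (x : X) : X.sum Y :=
  (Sum.inl x : X ⊕ Y)

/-- The right inclusion into a disjoint union. -/
def inr {C G : Type u} [CommGroup C] [Group G] {X Y : FibredSet C G} (y : Y) : X.sum Y :=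
  (Sum.inr y : X ⊕ Y)

section Composition

variable {C G H K : Type u} [CommGroup C] [Group G] [Group H] [Group K]

/-- `(t, y)` and `(t', y')` lie in the same orbit for the action
`(h, c) (t, y) = ((h, c) t, (h, c⁻¹) y)` of `H × C` on `T × Y`. -/
def orbitSetoid (T : FibredSet C (G × H)) (Y : FibredSet C (H × K)) : Setoid (T × Y) where
  r p q := ∃ (h : H) (c : C),
    q = ((((1 : G), h), c) • p.1, ((h, (1 : K)), c⁻¹) • p.2)
  iseqv :=
    { refl := fun p => ⟨1, 1, by
        have e1 : (((1 : G), (1 : H)), (1 : C)) = 1 := rfl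
        have e2 : (((1 : H), (1 : K)), (1 : C)) = 1 := rfl
        simp [e1, e2]⟩
      symm := by
        rintro p q ⟨h, c, rfl⟩
        refine ⟨h⁻¹, c⁻¹, ?_⟩
        have e1 : (((1 : G), (1 : H)), (1 : C)) = 1 := rfl
        have e2 : (((1 : H), (1 : K)), (1 : C)) = 1 := rfl
        simp [smul_smul, e1, e2]
      trans := by
        rintro p q r ⟨h, c, rfl⟩ ⟨h', c', rfl⟩
        refine ⟨h' * h, c' * c, ?_⟩
        simp [smul_smul, mul_comm] }

/-- The set of `(H × C)`-orbits of `T × Y`. -/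
abbrev Orbits (T : FibredSet C (G × H)) (Y : FibredSet C (H × K)) : Type u :=
  Quotient (orbitSetoid T Y)

/-- The action of `G × K × C` on the orbits: `(g, k, c) [t, y] = [(g, 1, c) t, (1, k, 1) y]`. -/
instance orbitsAction (T : FibredSet C (G × H)) (Y : FibredSet C (H × K)) :
    MulAction ((G × K) × C) (Orbits T Y) where
  smul a := Quotient.map (fun p => (((a.1.1, (1 : H)), a.2) • p.1,
      (((1 : H), a.1.2), (1 : C)) • p.2)) (by
    rintro p q ⟨h, c, rfl⟩
    refine ⟨h, c, ?_⟩
    simp [smul_smul, mul_comm])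
  one_smul := by
    rintro ⟨t, y⟩
    have e1 : (((1 : G), (1 : H)), (1 : C)) = 1 := rfl
    have e2 : (((1 : H), (1 : K)), (1 : C)) = 1 := rfl
    refine congrArg (Quotient.mk (orbitSetoid T Y)) (Prod.ext ?_ ?_)
    · exact one_smul _ t
    · exact one_smul _ y
  mul_smul := by
    rintro a b ⟨t, y⟩
    refine congrArg (Quotient.mk (orbitSetoid T Y)) (Prod.ext ?_ ?_)
    · change ((_, _), _) • t = ((_, _), _) • ((_, _), _) • t
      simp [smul_smul]
    · change ((_, _), _) • y = ((_, _), _) • ((_, _), _) • y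
      simp [smul_smul]

/-- The composition `T ∘ Y` of a `C`-fibred `(G × H)`-set and a `C`-fibred `(H × K)`-set: the
`(H × C)`-orbits of `T × Y` on which `C` acts freely. -/
def comp (T : FibredSet C (G × H)) (Y : FibredSet C (H × K)) : FibredSet C (G × K) :=
  freePart C (G × K) (Orbits T Y)

end Composition

/-- The identity `C`-fibred `(G × G)`-set `C (G × G) / Δ(G) = (G × G × C) / {(g, g, 1)}`, realized
as `G × C` with `(a, b, c) (g, d) = (a g b⁻¹, c d)`. -/
def unit (C G : Type u) [CommGroup C] [Group G] [Finite C] [Finite G] : FibredSet C (G × G) where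
  carrier := G × C
  action :=
    { smul := fun a x => (a.1.1 * x.1 * a.1.2⁻¹, a.2 * x.2)
      one_smul := fun x => by
        change (_, _) = x
        simp
      mul_smul := fun a b x => by
        change (_, _) = (_ * (_ * _ * _) * _, _ * (_ * _))
        simp [mul_assoc] }
  free := fun c x h => by
    have h2 : c * x.2 = x.2 := congrArg Prod.snd h
    simpa using h2

end FibredSet

namespace FibredSet

/-! Isomorphisms needed for the laws of the composition. -/

section Iso

variable {C G : Type u} [CommGroup C] [Group G]

theorem Iso.refl (X : FibredSet C G) : Iso X X := ⟨Equiv.refl _, fun _ _ => rfl⟩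

theorem Iso.symm {X Y : FibredSet C G} (h : Iso X Y) : Iso Y X := by
  obtain ⟨e, he⟩ := h
  exact ⟨e.symm, fun a y => e.injective (by simp [he])⟩

/-- Two fibred sets are isomorphic if they are quotients of a common set by the same relation,
compatibly with the actions. -/
theorem Iso.of_rep {X Y : FibredSet C G} {P : Type*} (f : P → X) (g : P → Y)
    (hf : Function.Surjective f) (hg : Function.Surjective g)
    (hfg : ∀ p q, f p = f q ↔ g p = g q)
    (hs : ∀ (a : G × C) (p : P), ∃ q, f q = a • f p ∧ g q = a • g p) : Iso X Y := by
  choose s hsf using hf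
  have key : ∀ p, g (s (f p)) = g p := fun p => (hfg _ _).1 (hsf _)
  refine ⟨Equiv.ofBijective (fun x => g (s x)) ⟨?_, ?_⟩, ?_⟩
  · intro x y h
    have := (hfg _ _).2 h
    rwa [hsf, hsf] at this
  · intro y
    obtain ⟨p, rfl⟩ := hg y
    exact ⟨f p, key p⟩
  · intro a x
    obtain ⟨q, h1, h2⟩ := hs a (s x)
    rw [hsf] at h1
    change g (s (a • x)) = a • g (s x)
    rw [← h2, ← h1, key]

end Iso

section Laws

variable {C G H K L : Type u} [CommGroup C] [Group G] [Group H] [Group K] [Group L]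

/-- `C` acts freely on the orbit of `(t, y)`. -/
def IsFree {T : FibredSet C (G × H)} {Y : FibredSet C (H × K)} (t : T) (y : Y) : Prop :=
  ∀ (h : H) (c d : C), (((1 : G), h), c) • t = (((1 : G), (1 : H)), d) • t →
    ((h, (1 : K)), c⁻¹) • y = y → d = 1

theorem orbits_mk_eq {T : FibredSet C (G × H)} {Y : FibredSet C (H × K)} {t t' : T} {y y' : Y} :
    (Quotient.mk (orbitSetoid T Y) (t, y) = Quotient.mk (orbitSetoid T Y) (t', y')) ↔
      ∃ (h : H) (c : C), t' = (((1 : G), h), c) • t ∧ y' = ((h, (1 : K)), c⁻¹) • y := by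
  rw [Quotient.eq]
  constructor
  · rintro ⟨h, c, e⟩
    exact ⟨h, c, congrArg Prod.fst e, congrArg Prod.snd e⟩
  · rintro ⟨h, c, rfl, rfl⟩
    exact ⟨h, c, rfl⟩

theorem orbits_smul_mk {T : FibredSet C (G × H)} {Y : FibredSet C (H × K)} (a : (G × K) × C)
    (t : T) (y : Y) : a • Quotient.mk (orbitSetoid T Y) (t, y) =
      Quotient.mk (orbitSetoid T Y)
        ((((a.1.1, (1 : H)), a.2) • t), ((((1 : H), a.1.2), (1 : C)) • y)) := rfl

theorem one_smul_right {T : FibredSet C (G × H)} (t : T) :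
    ((((1 : G), (1 : H)), (1 : C)) • t) = t := one_smul _ t

theorem isFree_iff {T : FibredSet C (G × H)} {Y : FibredSet C (H × K)} (t : T) (y : Y) :
    IsFree t y ↔ ∀ c : C, ((1 : G × K), c) • Quotient.mk (orbitSetoid T Y) (t, y) =
      Quotient.mk (orbitSetoid T Y) (t, y) → c = 1 := by
  constructor
  · intro hf d hd
    rw [orbits_smul_mk, eq_comm, orbits_mk_eq] at hd
    obtain ⟨h, c, h1, h2⟩ := hd
    refine hf h c d h1.symm (h2.symm.trans ?_)
    exact one_smul_right y
  · intro hf h c d h1 h2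
    refine hf d ?_
    rw [orbits_smul_mk, eq_comm, orbits_mk_eq]
    refine ⟨h, c, h1.symm, ?_⟩
    rw [h2]
    exact one_smul_right y

/-- The element of `T ∘ Y` given by a free orbit. -/
def comp.mk {T : FibredSet C (G × H)} {Y : FibredSet C (H × K)} (t : T) (y : Y)
    (h : IsFree t y) : T.comp Y :=
  ⟨Quotient.mk _ (t, y), (isFree_iff t y).1 h⟩

theorem comp.exists_mk {T : FibredSet C (G × H)} {Y : FibredSet C (H × K)} (x : T.comp Y) :
    ∃ (t : T) (y : Y) (h : IsFree t y), comp.mk t y h = x := by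
  obtain ⟨⟨t, y⟩, h⟩ := x
  exact ⟨t, y, (isFree_iff t y).2 h, rfl⟩

theorem comp.mk_eq {T : FibredSet C (G × H)} {Y : FibredSet C (H × K)} {t t' : T} {y y' : Y}
    {h : IsFree t y} {h' : IsFree t' y'} : comp.mk t y h = comp.mk t' y' h' ↔
      ∃ (h : H) (c : C), t' = (((1 : G), h), c) • t ∧ y' = ((h, (1 : K)), c⁻¹) • y :=
  Subtype.ext_iff.trans orbits_mk_eq

theorem comp.mk_congr {T : FibredSet C (G × H)} {Y : FibredSet C (H × K)} {t t' : T} {y y' : Y}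
    {h : IsFree t y} {h' : IsFree t' y'} (e1 : t = t') (e2 : y = y') :
    comp.mk t y h = comp.mk t' y' h' := by
  subst e1 e2
  rfl

theorem comp.smul_mk {T : FibredSet C (G × H)} {Y : FibredSet C (H × K)} (a : (G × K) × C)
    {t : T} {y : Y} (h : IsFree t y) : ∃ h', a • comp.mk t y h =
      comp.mk ((((a.1.1, (1 : H)), a.2) • t)) ((((1 : H), a.1.2), (1 : C)) • y) h' :=
  ⟨(isFree_iff _ _).2 (a • comp.mk t y h).2, rfl⟩

/-- A fibred set is isomorphic to a disjoint union if it is covered by disjoint copies of both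
summands. -/
theorem Iso.of_sum {X Y Z : FibredSet C G} (f : X → Z) (g : Y → Z)
    (hf : Function.Injective f) (hg : Function.Injective g) (hfg : ∀ x y, f x ≠ g y)
    (hs : ∀ z, (∃ x, f x = z) ∨ ∃ y, g y = z)
    (hf' : ∀ (a : G × C) x, f (a • x) = a • f x) (hg' : ∀ (a : G × C) y, g (a • y) = a • g y) :
    Iso (X.sum Y) Z := by
  refine ⟨Equiv.ofBijective (Sum.elim f g : X ⊕ Y → Z) ⟨?_, ?_⟩, ?_⟩
  · exact hf.sumElim hg hfg
  · intro z
    rcases hs z with ⟨x, rfl⟩ | ⟨y, rfl⟩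
    · exact ⟨Sum.inl x, rfl⟩
    · exact ⟨Sum.inr y, rfl⟩
  · rintro a (x | y)
    · exact hf' a x
    · exact hg' a y

/-- An injective equivariant pair of maps induces an injective equivariant map of composites. -/
theorem comp.exists_map {T T' : FibredSet C (G × H)} {Y Y' : FibredSet C (H × K)}
    (e : T → T') (f : Y → Y') (he : Function.Injective e) (hf : Function.Injective f)
    (he' : ∀ (a : (G × H) × C) t, e (a • t) = a • e t)
    (hf' : ∀ (a : (H × K) × C) y, f (a • y) = a • f y) :
    (∀ (t : T) (y : Y), IsFree t y ↔ IsFree (e t) (f y)) ∧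
    ∃ F : T.comp Y → T'.comp Y', Function.Injective F ∧ (∀ (a : (G × K) × C) x,
      F (a • x) = a • F x) ∧ ∀ t y h, ∃ h', F (comp.mk t y h) = comp.mk (e t) (f y) h' := by
  have hfree : ∀ (t : T) (y : Y), IsFree t y ↔ IsFree (e t) (f y) := by
    intro t y
    simp only [IsFree, ← he', ← hf', he.eq_iff, hf.eq_iff]
  refine ⟨hfree, ?_⟩
  have hF : ∀ x : T.comp Y, ∃ z : T'.comp Y', ∀ t y h, comp.mk t y h = x →
      ∃ h', z = comp.mk (e t) (f y) h' := by
    intro x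
    obtain ⟨t, y, h, rfl⟩ := comp.exists_mk x
    refine ⟨comp.mk (e t) (f y) ((hfree _ _).1 h), fun t' y' h' e' => ?_⟩
    refine ⟨(hfree _ _).1 h', ?_⟩
    rw [eq_comm, comp.mk_eq] at e'
    obtain ⟨a, c, rfl, rfl⟩ := e'
    rw [comp.mk_eq]
    exact ⟨a, c, he' _ _, hf' _ _⟩
  choose F hF using hF
  refine ⟨F, ?_, ?_, fun t y h => hF _ t y h rfl⟩
  · intro x x' hx
    obtain ⟨t, y, h, rfl⟩ := comp.exists_mk x
    obtain ⟨t', y', h', rfl⟩ := comp.exists_mk x'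
    obtain ⟨h1, e1⟩ := hF _ t y h rfl
    obtain ⟨h2, e2⟩ := hF _ t' y' h' rfl
    rw [e1, e2, comp.mk_eq] at hx
    rw [comp.mk_eq]
    simpa only [← he', ← hf', he.eq_iff, hf.eq_iff] using hx
  · intro a x
    obtain ⟨t, y, h, rfl⟩ := comp.exists_mk x
    obtain ⟨h1, e1⟩ := hF _ t y h rfl
    obtain ⟨h2, e2⟩ := comp.smul_mk a h
    obtain ⟨h3, e3⟩ := comp.smul_mk a h1
    obtain ⟨h4, e4⟩ := hF _ _ _ h2 rfl
    rw [e2, e4, e1, e3]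
    simp only [he', hf']

theorem comp_congr {T T' : FibredSet C (G × H)} {Y Y' : FibredSet C (H × K)}
    (hT : Iso T T') (hY : Iso Y Y') : Iso (T.comp Y) (T'.comp Y') := by
  obtain ⟨e, he⟩ := hT
  obtain ⟨f, hf⟩ := hY
  obtain ⟨hfree, F, hF, hF', hFm⟩ := comp.exists_map e f e.injective f.injective he hf
  refine ⟨Equiv.ofBijective F ⟨hF, ?_⟩, hF'⟩
  intro x
  obtain ⟨t, y, h, rfl⟩ := comp.exists_mk x
  obtain ⟨t, rfl⟩ := e.surjective t
  obtain ⟨y, rfl⟩ := f.surjective y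
  obtain ⟨h', e'⟩ := hFm t y ((hfree _ _).2 h)
  exact ⟨_, e'⟩

theorem sum_comp (T T' : FibredSet C (G × H)) (Y : FibredSet C (H × K)) :
    Iso ((T.comp Y).sum (T'.comp Y)) ((T.sum T').comp Y) := by
  obtain ⟨hl, F, hF, hF', hFm⟩ := comp.exists_map (T := T) (T' := T.sum T') (Y := Y) (Y' := Y)
    inl id (fun _ _ h => Sum.inl.inj h) Function.injective_id (fun _ _ => rfl) (fun _ _ => rfl)
  obtain ⟨hr, F', hF2, hF2', hFm'⟩ := comp.exists_map (T := T') (T' := T.sum T') (Y := Y) (Y' := Y)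
    inr id (fun _ _ h => Sum.inr.inj h) Function.injective_id (fun _ _ => rfl) (fun _ _ => rfl)
  refine Iso.of_sum F F' hF hF2 ?_ ?_ hF' hF2'
  · intro x x' e
    obtain ⟨t, y, h, rfl⟩ := comp.exists_mk x
    obtain ⟨t', y', h', rfl⟩ := comp.exists_mk x'
    obtain ⟨h1, e1⟩ := hFm t y h
    obtain ⟨h2, e2⟩ := hFm' t' y' h'
    rw [e1, e2, comp.mk_eq] at e
    obtain ⟨a, c, h3, -⟩ := e
    exact Sum.inr_ne_inl h3
  · intro z
    obtain ⟨t | t, y, h, rfl⟩ := comp.exists_mk z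
    · obtain ⟨h1, e1⟩ := hFm t y ((hl t y).2 h)
      exact Or.inl ⟨_, e1⟩
    · obtain ⟨h1, e1⟩ := hFm' t y ((hr t y).2 h)
      exact Or.inr ⟨_, e1⟩

theorem comp_sum (T : FibredSet C (G × H)) (Y Y' : FibredSet C (H × K)) :
    Iso ((T.comp Y).sum (T.comp Y')) (T.comp (Y.sum Y')) := by
  obtain ⟨hl, F, hF, hF', hFm⟩ := comp.exists_map (T := T) (T' := T) (Y := Y) (Y' := Y.sum Y')
    id inl Function.injective_id (fun _ _ h => Sum.inl.inj h) (fun _ _ => rfl) (fun _ _ => rfl)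
  obtain ⟨hr, F', hF2, hF2', hFm'⟩ := comp.exists_map (T := T) (T' := T) (Y := Y') (Y' := Y.sum Y')
    id inr Function.injective_id (fun _ _ h => Sum.inr.inj h) (fun _ _ => rfl) (fun _ _ => rfl)
  refine Iso.of_sum F F' hF hF2 ?_ ?_ hF' hF2'
  · intro x x' e
    obtain ⟨t, y, h, rfl⟩ := comp.exists_mk x
    obtain ⟨t', y', h', rfl⟩ := comp.exists_mk x'
    obtain ⟨h1, e1⟩ := hFm t y h
    obtain ⟨h2, e2⟩ := hFm' t' y' h'
    rw [e1, e2, comp.mk_eq] at e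
    obtain ⟨a, c, -, h3⟩ := e
    exact Sum.inr_ne_inl h3
  · intro z
    obtain ⟨t, y | y, h, rfl⟩ := comp.exists_mk z
    · obtain ⟨h1, e1⟩ := hFm t y ((hl t y).2 h)
      exact Or.inl ⟨_, e1⟩
    · obtain ⟨h1, e1⟩ := hFm' t y ((hr t y).2 h)
      exact Or.inr ⟨_, e1⟩

/-- `C` acts freely on the orbit of `(t, y, z)` in the threefold composition. -/
def IsFree₃ {T : FibredSet C (G × H)} {Y : FibredSet C (H × K)} {Z : FibredSet C (K × L)}
    (t : T) (y : Y) (z : Z) : Prop :=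
  ∀ (h : H) (k : K) (c c' d : C), (((1 : G), h), c) • t = (((1 : G), (1 : H)), d) • t →
    ((h, k), c⁻¹ * c') • y = y → ((k, (1 : L)), c'⁻¹) • z = z → d = 1

section Assoc

variable {T : FibredSet C (G × H)} {Y : FibredSet C (H × K)} {Z : FibredSet C (K × L)}

theorem mk_left_eq {t t' : T} {y y' : Y} {z z' : Z} {h1 : IsFree t y} {h1' : IsFree t' y'} :
    (∃ (k : K) (c : C), comp.mk t' y' h1' = (((1 : G), k), c) • comp.mk t y h1 ∧
      z' = ((k, (1 : L)), c⁻¹) • z) ↔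
    ∃ (h : H) (k : K) (c c' : C), t' = (((1 : G), h), c) • t ∧ y' = ((h, k), c⁻¹ * c') • y ∧
      z' = ((k, (1 : L)), c'⁻¹) • z := by
  constructor
  · rintro ⟨k, c, e, ez⟩
    obtain ⟨h2, e2⟩ := comp.smul_mk (((1 : G), k), c) h1
    rw [e2, eq_comm, comp.mk_eq] at e
    obtain ⟨h, d, rfl, rfl⟩ := e
    exact ⟨h, k, d * c, c, by simp [smul_smul], by simp [smul_smul], ez⟩
  · rintro ⟨h, k, c, c', e1, e2, ez⟩
    refine ⟨k, c', ?_, ez⟩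
    obtain ⟨h2, e3⟩ := comp.smul_mk (((1 : G), k), c') h1
    rw [e3, eq_comm, comp.mk_eq]
    exact ⟨h, c * c'⁻¹, by simp [smul_smul, e1], by simp [smul_smul, e2, mul_comm]⟩

theorem mk_right_eq {t t' : T} {y y' : Y} {z z' : Z} {h1 : IsFree y z} {h1' : IsFree y' z'} :
    (∃ (h : H) (c : C), t' = (((1 : G), h), c) • t ∧
      comp.mk y' z' h1' = ((h, (1 : L)), c⁻¹) • comp.mk y z h1) ↔
    ∃ (h : H) (k : K) (c c' : C), t' = (((1 : G), h), c) • t ∧ y' = ((h, k), c⁻¹ * c') • y ∧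
      z' = ((k, (1 : L)), c'⁻¹) • z := by
  constructor
  · rintro ⟨h, c, et, e⟩
    obtain ⟨h2, e2⟩ := comp.smul_mk ((h, (1 : L)), c⁻¹) h1
    rw [e2, eq_comm, comp.mk_eq] at e
    obtain ⟨k, d, rfl, rfl⟩ := e
    exact ⟨h, k, c, d, et, by simp [smul_smul, mul_comm], by simp [smul_smul]⟩
  · rintro ⟨h, k, c, c', et, e1, e2⟩
    refine ⟨h, c, et, ?_⟩
    obtain ⟨h2, e3⟩ := comp.smul_mk ((h, (1 : L)), c⁻¹) h1
    rw [e3, eq_comm, comp.mk_eq]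
    exact ⟨k, c', by simp [smul_smul, e1, mul_comm], by simp [smul_smul, e2]⟩

theorem isFree_left_iff (t : T) (y : Y) (z : Z) :
    (∃ h1 : IsFree t y, IsFree (comp.mk t y h1) z) ↔ IsFree₃ t y z := by
  have key : ∀ (h1 : IsFree t y), IsFree (comp.mk t y h1) z ↔ IsFree₃ t y z := by
    intro h1
    have e : ∀ d : C, (∃ (k : K) (c : C), (((1 : G), (1 : K)), d) • comp.mk t y h1 =
        (((1 : G), k), c) • comp.mk t y h1 ∧ z = ((k, (1 : L)), c⁻¹) • z) ↔
        ∃ (h : H) (k : K) (c c' : C), (((1 : G), (1 : H)), d) • t = (((1 : G), h), c) • t ∧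
          y = ((h, k), c⁻¹ * c') • y ∧ z = ((k, (1 : L)), c'⁻¹) • z := by
      intro d
      obtain ⟨h2, e2⟩ := comp.smul_mk (((1 : G), (1 : K)), d) h1
      rw [e2, mk_left_eq]
      have e3 : (((1 : H), (1 : K)), (1 : C)) • y = y := one_smul_right y
      simp only [e3]
    constructor
    · intro hf h k c c' d a1 a2 a3
      obtain ⟨k', c', a4, a5⟩ := (e d).2 ⟨h, k, c, c', a1.symm, a2.symm, a3.symm⟩
      exact hf k' c' d a4.symm a5.symm
    · intro hf k c d a1 a2
      obtain ⟨h, k, c, c', a3, a4, a5⟩ := (e d).1 ⟨k, c, a1.symm, a2.symm⟩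
      exact hf h k c c' d a3.symm a4.symm a5.symm
  constructor
  · rintro ⟨h1, h2⟩
    exact (key h1).1 h2
  · intro hf
    have h1 : IsFree t y := fun h c d a1 a2 =>
      hf h 1 c 1 d a1 (by simpa using a2) (by simpa using one_smul_right z)
    exact ⟨h1, (key h1).2 hf⟩

theorem isFree_right_iff (t : T) (y : Y) (z : Z) :
    (∃ h1 : IsFree y z, IsFree t (comp.mk y z h1)) ↔ IsFree₃ t y z := by
  have key : ∀ (h1 : IsFree y z), IsFree t (comp.mk y z h1) ↔ IsFree₃ t y z := by
    intro h1
    have e : ∀ d : C, (∃ (h : H) (c : C), (((1 : G), (1 : H)), d) • t = (((1 : G), h), c) • t ∧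
        comp.mk y z h1 = ((h, (1 : L)), c⁻¹) • comp.mk y z h1) ↔
        ∃ (h : H) (k : K) (c c' : C), (((1 : G), (1 : H)), d) • t = (((1 : G), h), c) • t ∧
          y = ((h, k), c⁻¹ * c') • y ∧ z = ((k, (1 : L)), c'⁻¹) • z :=
      fun d => mk_right_eq
    constructor
    · intro hf h k c c' d a1 a2 a3
      obtain ⟨h', c', a4, a5⟩ := (e d).2 ⟨h, k, c, c', a1.symm, a2.symm, a3.symm⟩
      exact hf h' c' d a4.symm a5.symm
    · intro hf h c d a1 a2
      obtain ⟨h, k, c, c', a3, a4, a5⟩ := (e d).1 ⟨h, c, a1.symm, a2.symm⟩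
      exact hf h k c c' d a3.symm a4.symm a5.symm
  constructor
  · rintro ⟨h1, h2⟩
    exact (key h1).1 h2
  · intro hf
    have h1 : IsFree y z := fun k c d a1 a2 =>
      hf 1 k d c d rfl (by
        have e1 : ((((1 : H), k), d⁻¹ * c)) • y =
            (((1 : H), (1 : K)), d⁻¹) • (((1 : H), k), c) • y := by simp [smul_smul]
        rw [e1, a1, smul_smul]
        simpa using one_smul_right y) a2
    exact ⟨h1, (key h1).2 hf⟩

end Assoc

theorem comp_assoc (T : FibredSet C (G × H)) (Y : FibredSet C (H × K))
    (Z : FibredSet C (K × L)) : Iso ((T.comp Y).comp Z) (T.comp (Y.comp Z)) := by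
  have hl := fun p : {p : T × Y × Z // IsFree₃ p.1 p.2.1 p.2.2} =>
    (isFree_left_iff p.1.1 p.1.2.1 p.1.2.2).2 p.2
  have hr := fun p : {p : T × Y × Z // IsFree₃ p.1 p.2.1 p.2.2} =>
    (isFree_right_iff p.1.1 p.1.2.1 p.1.2.2).2 p.2
  choose l1 l2 using hl
  choose r1 r2 using hr
  refine Iso.of_rep (fun p => comp.mk _ _ (l2 p)) (fun p => comp.mk _ _ (r2 p)) ?_ ?_ ?_ ?_
  · intro x
    obtain ⟨w, z, h2, rfl⟩ := comp.exists_mk x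
    obtain ⟨t, y, h1, rfl⟩ := comp.exists_mk w
    exact ⟨⟨(t, y, z), (isFree_left_iff t y z).1 ⟨h1, h2⟩⟩, rfl⟩
  · intro x
    obtain ⟨t, w, h2, rfl⟩ := comp.exists_mk x
    obtain ⟨y, z, h1, rfl⟩ := comp.exists_mk w
    exact ⟨⟨(t, y, z), (isFree_right_iff t y z).1 ⟨h1, h2⟩⟩, rfl⟩
  · intro p q
    rw [comp.mk_eq, comp.mk_eq, mk_left_eq, mk_right_eq]
  · rintro ⟨⟨g, m⟩, c⟩ p
    obtain ⟨⟨t, y, z⟩, hp⟩ := p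
    have hq : IsFree₃ (((g, (1 : H)), c) • t) y ((((1 : K), m), (1 : C)) • z) := by
      intro h k c1 c2 d a1 a2 a3
      refine hp h k c1 c2 d ?_ a2 ?_
      · refine MulAction.injective ((g, (1 : H)), c) ?_
        simpa [smul_smul, mul_comm] using a1
      · refine MulAction.injective (((1 : K), m), (1 : C)) ?_
        simpa [smul_smul, mul_comm] using a3
    refine ⟨⟨(_, _, _), hq⟩, ?_, ?_⟩
    · obtain ⟨h1, e1⟩ := comp.smul_mk ((g, m), c) (l2 ⟨(t, y, z), hp⟩)
      obtain ⟨h2, e2⟩ := comp.smul_mk ((g, (1 : K)), c) (l1 ⟨(t, y, z), hp⟩)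
      rw [e1]
      refine comp.mk_congr ?_ rfl
      rw [e2]
      exact comp.mk_congr rfl (one_smul_right y).symm
    · obtain ⟨h1, e1⟩ := comp.smul_mk ((g, m), c) (r2 ⟨(t, y, z), hp⟩)
      obtain ⟨h2, e2⟩ := comp.smul_mk (((1 : H), m), (1 : C)) (r1 ⟨(t, y, z), hp⟩)
      rw [e1]
      refine comp.mk_congr rfl ?_
      rw [e2]
      exact comp.mk_congr (one_smul_right y).symm rfl

/-- The element `(g, c)` of the identity fibred set. -/
def unit.mk [Finite C] [Finite G] (g : G) (c : C) : unit C G := (g, c)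

theorem unit.exists_mk [Finite C] [Finite G] (x : unit C G) : ∃ g c, unit.mk g c = x :=
  ⟨x.1, x.2, rfl⟩

theorem unit.mk_eq [Finite C] [Finite G] {g g' : G} {c c' : C} :
    unit.mk g c = unit.mk g' c' ↔ g = g' ∧ c = c' := Prod.ext_iff

theorem unit.smul_mk [Finite C] [Finite G] (a b g : G) (c d : C) :
    ((a, b), c) • unit.mk g d = unit.mk (a * g * b⁻¹) (c * d) := rfl

theorem comp_unit [Finite C] [Finite H] (T : FibredSet C (G × H)) :
    Iso (T.comp (unit C H)) T := by
  have hfree : ∀ (t : T) (g : H) (e : C), IsFree t (unit.mk g e) := by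
    intro t g e h c d a1 a2
    rw [unit.smul_mk, unit.mk_eq] at a2
    obtain ⟨a3, a4⟩ := a2
    simp at a3 a4
    subst a3 a4
    rw [one_smul_right] at a1
    exact T.free d t a1.symm
  refine Iso.of_rep (P := T × (H × C)) (fun p => comp.mk p.1 _ (hfree p.1 p.2.1 p.2.2))
    (fun p => (((1 : G), p.2.1⁻¹), p.2.2) • p.1) ?_ ?_ ?_ ?_
  · intro x
    obtain ⟨t, y, h, rfl⟩ := comp.exists_mk x
    obtain ⟨g, c, rfl⟩ := unit.exists_mk y
    exact ⟨(t, (g, c)), rfl⟩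
  · intro t
    exact ⟨(t, 1), by simpa using one_smul_right t⟩
  · rintro ⟨t, h, c⟩ ⟨t', h', c'⟩
    simp only [comp.mk_eq, unit.smul_mk, unit.mk_eq]
    constructor
    · rintro ⟨k, d, rfl, rfl, rfl⟩
      simp [smul_smul]
    · intro e
      refine ⟨h' * h⁻¹, c * c'⁻¹, ?_, by simp, by simp⟩
      refine MulAction.injective (((1 : G), h'⁻¹), c') ?_
      simp only [← e]
      simp [smul_smul]
  · rintro ⟨⟨g, k⟩, c⟩ ⟨t, h, d⟩
    refine ⟨((((g, (1 : H)), c) • t), (h * k⁻¹, d)), ?_, ?_⟩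
    · obtain ⟨h2, e2⟩ := comp.smul_mk ((g, k), c) (hfree t h d)
      rw [e2]
      refine comp.mk_congr rfl ?_
      rw [unit.smul_mk]
      simp
    · simp [smul_smul, mul_comm]

theorem unit_comp [Finite C] [Finite G] (T : FibredSet C (G × H)) :
    Iso ((unit C G).comp T) T := by
  have hfree : ∀ (g : G) (e : C) (t : T), IsFree (unit.mk g e) t := by
    intro g e t h c d a1 a2
    rw [unit.smul_mk, unit.smul_mk, unit.mk_eq] at a1
    obtain ⟨a3, a4⟩ := a1
    simp at a3 a4
    subst a3 a4
    exact inv_eq_one.1 (T.free _ t a2)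
  refine Iso.of_rep (P := (G × C) × T) (fun p => comp.mk _ p.2 (hfree p.1.1 p.1.2 p.2))
    (fun p => ((p.1.1, (1 : H)), p.1.2) • p.2) ?_ ?_ ?_ ?_
  · intro x
    obtain ⟨y, t, h, rfl⟩ := comp.exists_mk x
    obtain ⟨g, c, rfl⟩ := unit.exists_mk y
    exact ⟨((g, c), t), rfl⟩
  · intro t
    exact ⟨(1, t), one_smul_right t⟩
  · rintro ⟨⟨h, c⟩, t⟩ ⟨⟨h', c'⟩, t'⟩
    simp only [comp.mk_eq, unit.smul_mk, unit.mk_eq]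
    constructor
    · rintro ⟨k, d, ⟨rfl, rfl⟩, rfl⟩
      simp [smul_smul, mul_comm]
    · intro e
      refine ⟨h'⁻¹ * h, c' * c⁻¹, ⟨by simp, by simp⟩, ?_⟩
      refine MulAction.injective ((h', (1 : H)), c') ?_
      simp only [← e]
      simp [smul_smul]
  · rintro ⟨⟨g, k⟩, c⟩ ⟨⟨h, d⟩, t⟩
    refine ⟨((g * h, c * d), ((((1 : G), k), (1 : C)) • t)), ?_, ?_⟩
    · obtain ⟨h2, e2⟩ := comp.smul_mk ((g, k), c) (hfree h d t)
      rw [e2]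
      refine comp.mk_congr ?_ rfl
      rw [unit.smul_mk]
      simp
    · simp [smul_smul]

end Laws

end FibredSet

/-- The relations defining the Grothendieck group of `C`-fibred `G`-sets (with coefficients in `R`):
isomorphic sets are identified, and disjoint unions become sums. -/
noncomputable def monomialBurnsideRelations (R : Type v) (C G : Type u) [CommRing R] [CommGroup C]
    [Group G] : Submodule R (FibredSet C G →₀ R) :=
  Submodule.span R
    ({f | ∃ X Y : FibredSet C G, X.Iso Y ∧ f = Finsupp.single X 1 - Finsupp.single Y 1} ∪
     {f | ∃ X Y : FibredSet C G, f = Finsupp.single (X.sum Y) 1 -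
       (Finsupp.single X 1 + Finsupp.single Y 1)})

/-- The monomial Burnside module `R B_C^1(G)`: the Grothendieck group of `C`-fibred `G`-sets with
respect to disjoint union, with coefficients in `R`. (Over `ℤ`, this is the subgroup of the
Burnside group `B(G × C)` generated by the `C`-fibred `G`-sets.) -/
abbrev MonomialBurnside (R : Type v) (C G : Type u) [CommRing R] [CommGroup C] [Group G] :
    Type (max (u + 1) v) :=
  (FibredSet C G →₀ R) ⧸ monomialBurnsideRelations R C G

namespace MonomialBurnside

section Basic

variable (R : Type v) {C G : Type u} [CommRing R] [CommGroup C] [Group G]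

/-- The class `[X]` of a `C`-fibred `G`-set. -/
noncomputable def cls (X : FibredSet C G) : MonomialBurnside R C G :=
  Submodule.Quotient.mk (Finsupp.single X 1)

theorem cls_eq_of_iso {X Y : FibredSet C G} (h : X.Iso Y) : cls R X = cls R Y :=
  (Submodule.Quotient.eq _).2 (Submodule.subset_span (Or.inl ⟨X, Y, h, rfl⟩))

theorem cls_sum (X Y : FibredSet C G) : cls R (X.sum Y) = cls R X + cls R Y :=
  (Submodule.Quotient.eq _).2 (Submodule.subset_span (Or.inr ⟨X, Y, rfl⟩))

variable {R} {M : Type*} [AddCommGroup M] [Module R M]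

/-- The linear extension of an isomorphism-invariant, additive function on fibred sets. -/
noncomputable def lift (f : FibredSet C G → M) (h1 : ∀ X Y, X.Iso Y → f X = f Y)
    (h2 : ∀ X Y, f (X.sum Y) = f X + f Y) : MonomialBurnside R C G →ₗ[R] M :=
  Submodule.liftQ _ (Finsupp.linearCombination R f) (by
    rw [monomialBurnsideRelations, Submodule.span_le]
    rintro g (⟨X, Y, h, rfl⟩ | ⟨X, Y, rfl⟩)
    · simp [h1 X Y h]
    · simp [h2 X Y])

theorem lift_cls (f : FibredSet C G → M) (h1 : ∀ X Y, X.Iso Y → f X = f Y)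
    (h2 : ∀ X Y, f (X.sum Y) = f X + f Y) (X : FibredSet C G) :
    lift (R := R) f h1 h2 (cls R X) = f X := by
  simp [lift, cls]

theorem hom_ext {f g : MonomialBurnside R C G →ₗ[R] M} (h : ∀ X, f (cls R X) = g (cls R X)) :
    f = g := by
  refine Submodule.linearMap_qext _ (Finsupp.lhom_ext' fun X => LinearMap.ext_ring ?_)
  exact h X

@[elab_as_elim]
theorem induction {p : MonomialBurnside R C G → Prop} (a : MonomialBurnside R C G)
    (cls : ∀ X, p (cls R X)) (add : ∀ a b, p a → p b → p (a + b))
    (smul : ∀ (r : R) a, p a → p (r • a)) : p a := by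
  obtain ⟨f, rfl⟩ := Submodule.Quotient.mk_surjective _ a
  induction f using Finsupp.induction_linear with
  | zero =>
    have h := smul 0 _ (cls (FibredSet.empty C G))
    rwa [zero_smul] at h
  | add f g hf hg => exact add _ _ hf hg
  | single X r =>
    have h := smul r _ (cls X)
    rwa [MonomialBurnside.cls, ← Submodule.Quotient.mk_smul, Finsupp.smul_single, smul_eq_mul,
      mul_one] at h

end Basic

section Comp

variable (R : Type v) {C G H K L : Type u} [CommRing R] [CommGroup C] [Group G] [Group H]
  [Group K] [Group L]

/-- The composition `R B_C^1(G × H) × R B_C^1(H × K) → R B_C^1(G × K)`: the bilinear extension of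
the composition of fibred sets. -/
noncomputable def comp : MonomialBurnside R C (G × H) →ₗ[R] MonomialBurnside R C (H × K) →ₗ[R]
    MonomialBurnside R C (G × K) :=
  lift
    (fun T => lift (fun Y => cls R (T.comp Y))
      (fun _ _ h => cls_eq_of_iso R (FibredSet.comp_congr (FibredSet.Iso.refl T) h))
      (fun Y Y' => by
        rw [← cls_sum]
        exact (cls_eq_of_iso R (FibredSet.comp_sum T Y Y')).symm))
    (fun T T' h => hom_ext fun Y => by
      simp only [lift_cls]
      exact cls_eq_of_iso R (FibredSet.comp_congr h (FibredSet.Iso.refl Y)))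
    (fun T T' => hom_ext fun Y => by
      simp only [lift_cls, LinearMap.add_apply, ← cls_sum]
      exact (cls_eq_of_iso R (FibredSet.sum_comp T T' Y)).symm)

theorem comp_cls (T : FibredSet C (G × H)) (Y : FibredSet C (H × K)) :
    comp R (cls R T) (cls R Y) = cls R (T.comp Y) := by
  simp only [comp, lift_cls]

theorem comp_assoc (a : MonomialBurnside R C (G × H)) (b : MonomialBurnside R C (H × K))
    (c : MonomialBurnside R C (K × L)) : comp R (comp R a b) c = comp R a (comp R b c) := by
  induction a using induction with
  | add a a' h h' => simp only [map_add, LinearMap.add_apply, h, h']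
  | smul r a h => simp only [map_smul, LinearMap.smul_apply, h]
  | cls T =>
    induction b using induction with
    | add b b' h h' => simp only [map_add, LinearMap.add_apply, h, h']
    | smul r b h => simp only [map_smul, LinearMap.smul_apply, h]
    | cls Y =>
      induction c using induction with
      | add c c' h h' => simp only [map_add, h, h']
      | smul r c h => simp only [map_smul, h]
      | cls Z =>
        simp only [comp_cls]
        exact cls_eq_of_iso R (FibredSet.comp_assoc T Y Z)

theorem unit_comp [Finite C] [Finite G] (a : MonomialBurnside R C (G × H)) :
    comp R (cls R (FibredSet.unit C G)) a = a := by
  have e : comp R (cls R (FibredSet.unit C G)) = (LinearMap.id (M := MonomialBurnside R C (G × H))) :=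
    hom_ext fun X => by
      rw [comp_cls, LinearMap.id_apply]
      exact cls_eq_of_iso R (FibredSet.unit_comp X)
  rw [e, LinearMap.id_apply]

theorem comp_unit [Finite C] [Finite H] (a : MonomialBurnside R C (G × H)) :
    comp R a (cls R (FibredSet.unit C H)) = a := by
  have e : (comp R).flip (cls R (FibredSet.unit C H)) =
      (LinearMap.id (M := MonomialBurnside R C (G × H))) :=
    hom_ext fun X => by
      rw [LinearMap.flip_apply, comp_cls, LinearMap.id_apply]
      exact cls_eq_of_iso R (FibredSet.comp_unit X)
  exact LinearMap.congr_fun e a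

end Comp

end MonomialBurnside

/-- An object of the category `P_{R B_C^1}`: a finite group. -/
structure FibredBisetCat (R : Type v) (C : Type u) where
  carrier : Type u
  [group : Group carrier]
  [finite : Finite carrier]

namespace FibredBisetCat

attribute [instance] FibredBisetCat.group FibredBisetCat.finite

variable {R : Type v} {C : Type u} [CommRing R] [CommGroup C] [Finite C]

/-- The category `P_{R B_C^1}`: the morphisms from `G` to `H` are the elements of
`R B_C^1(H × G)`, composed by `∘`. -/
noncomputable instance category : Category.{max (u + 1) v} (FibredBisetCat R C) where
  Hom G H := MonomialBurnside R C (H.carrier × G.carrier)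
  id G := MonomialBurnside.cls R (FibredSet.unit C G.carrier)
  comp f g := MonomialBurnside.comp R g f
  id_comp f := MonomialBurnside.comp_unit R f
  comp_id f := MonomialBurnside.unit_comp R f
  assoc f g h := (MonomialBurnside.comp_assoc R h g f).symm

noncomputable instance preadditive : Preadditive (FibredBisetCat R C) where
  homGroup G H := inferInstanceAs (AddCommGroup (MonomialBurnside R C (H.carrier × G.carrier)))
  add_comp _ _ _ f f' g := (MonomialBurnside.comp R g).map_add f f'
  comp_add _ _ _ f g g' := LinearMap.map_add₂ (MonomialBurnside.comp R) g g' f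

noncomputable instance linear : Linear R (FibredBisetCat R C) where
  homModule G H := inferInstanceAs (Module R (MonomialBurnside R C (H.carrier × G.carrier)))
  smul_comp _ _ _ r f g := (MonomialBurnside.comp R g).map_smul r f
  comp_smul _ _ _ f r g := LinearMap.map_smul₂ (MonomialBurnside.comp R) r g f

/-- A finite group `H` is minimal for `S` if `S(H) ≠ 0` and `S(K) = 0` for every finite group `K` of
order smaller than `|H|`. -/
def IsMinimalGroup (S : FibredBisetCat R C ⥤ ModuleCat.{w} R) (H : FibredBisetCat R C) : Prop :=
  Nontrivial (S.obj H) ∧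
    ∀ K : FibredBisetCat R C, Nat.card K.carrier < Nat.card H.carrier → Subsingleton (S.obj K)

end FibredBisetCat

/-! Two minimal groups of `S` have the same order, since `S` is nonzero at both. A simple functor is
generated by any of its nonzero values, so some morphism from `H` to `K` acts nontrivially
(`exists_map_ne_zero_of_simple`). By linearity it may be taken to be the class of a transitive
fibred set `X` (`exists_transitive_ne_zero`). As `S` vanishes on groups of smaller order, `X` is not
a composite through any such group (`map_cls_eq_zero`).

Let `D ≤ K × H × C` be the stabilizer of a point of `X`. If `D` did not project onto `K`, then `X`
would be induced from the projection (`factorsThrough_leftProj`). If `D` met `K` nontrivially, the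
intersection would be normal in `K` and act trivially, and `X` would be inflated from the quotient
(`factorsThrough_quotient`). Both are excluded, and exchanging the two sides gives the same for `H`.

Without `C`, the group `D` would now be the graph of an isomorphism. In general the kernel of `D →
K` embeds in `C`, so its order is 1 or the prime `|C|`. In the first case `D` maps isomorphically
onto `K` and `H`; in the second the kernel of `D → C` does (`nonempty_mulEquiv_of_subgroup_prod`).
-/

namespace FibredSet

/-! ### Recognizing composites of fibred sets. -/

section Factorization

variable {C G H Q : Type u} [CommGroup C] [Group G] [Group H] [Group Q]

/-- The `C`-fibred `(G × Q)`-set `M × C` attached to homomorphisms `G → M ← Q`, with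
`(a, b, c) (g, d) = (α(a) g β(b)⁻¹, c d)`. -/
def ofHoms {M : Type u} [Group M] [Finite M] [Finite C] (α : G →* M) (β : Q →* M) :
    FibredSet C (G × Q) where
  carrier := M × C
  action :=
    { smul := fun a x => (α a.1.1 * x.1 * (β a.1.2)⁻¹, a.2 * x.2)
      one_smul := fun x => by
        change (_, _) = x
        simp
      mul_smul := fun a b x => by
        change (_, _) = (_ * (_ * _ * _) * _, _ * (_ * _))
        simp [mul_assoc] }
  free := fun c x h => by
    have h2 : c * x.2 = x.2 := congrArg Prod.snd h
    simpa using h2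

theorem ofHoms_smul {M : Type u} [Group M] [Finite M] [Finite C] (α : G →* M) (β : Q →* M)
    (a : (G × Q) × C) (x : M × C) :
    (a • (show ofHoms (C := C) α β from x)) =
      (show ofHoms (C := C) α β from (α a.1.1 * x.1 * (β a.1.2)⁻¹, a.2 * x.2)) := rfl

/-- A balanced, equivariant and universal pairing `T × Y → X`, exhibiting `X` as the composite
of `T` and `Y`. -/
structure IsComposite (T : FibredSet C (G × Q)) (Y : FibredSet C (Q × H))
    (X : FibredSet C (G × H)) (m : T → Y → X) : Prop where
  smul : ∀ (g : G) (h : H) (c d : C) t y,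
    m (((g, (1 : Q)), c) • t) ((((1 : Q), h), d) • y) = ((g, h), c * d) • m t y
  balanced : ∀ (q : Q) t y,
    m ((((1 : G), q), (1 : C)) • t) (((q, (1 : H)), (1 : C)) • y) = m t y
  surjective : ∀ x, ∃ t y, m t y = x
  rel : ∀ t y t' y', m t y = m t' y' →
    ∃ (q : Q) (c : C), t' = (((1 : G), q), c) • t ∧ y' = ((q, (1 : H)), c⁻¹) • y

namespace IsComposite

variable {T : FibredSet C (G × Q)} {Y : FibredSet C (Q × H)} {X : FibredSet C (G × H)}
  {m : T → Y → X}

/-- The `C`-components of both arguments come out of `m` as a product, so `c` and `c⁻¹` cancel. -/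
theorem balanced' (hm : IsComposite T Y X m) (q : Q) (c : C) (t : T) (y : Y) :
    m ((((1 : G), q), c) • t) (((q, (1 : H)), c⁻¹) • y) = m t y := by
  have h := hm.smul 1 1 c c⁻¹ ((((1 : G), q), (1 : C)) • t) (((q, (1 : H)), (1 : C)) • y)
  rw [hm.balanced, mul_inv_cancel, show (((1 : G), (1 : H)), (1 : C)) = 1 from rfl, one_smul] at h
  simpa [smul_smul] using h

/-- An element of `C` fixing the orbit of `(t, y)` also fixes `m t y`, and `C` acts freely on `X`.
Hence passing to the free part in the composition discards nothing. -/
theorem isFree (hm : IsComposite T Y X m) (t : T) (y : Y) : IsFree t y := by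
  intro h c d h1 h2
  have e := hm.balanced' h c t y
  rw [h1, h2] at e
  have e' := hm.smul 1 1 d 1 t y
  rw [show (((1 : Q), (1 : H)), (1 : C)) = 1 from rfl, one_smul, e, mul_one] at e'
  exact X.free d _ e'.symm

/-- Both sides are quotients of `T × Y`, and `rel` together with `balanced'` says that the two
equivalence relations agree. -/
theorem iso (hm : IsComposite T Y X m) : Iso X (T.comp Y) := by
  refine Iso.of_rep (P := T × Y) (fun p => m p.1 p.2) (fun p => comp.mk p.1 p.2 (hm.isFree _ _))
    (fun x => ?_) (fun x => ?_) ?_ ?_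
  · obtain ⟨t, y, h⟩ := hm.surjective x
    exact ⟨(t, y), h⟩
  · obtain ⟨t, y, h, rfl⟩ := comp.exists_mk x
    exact ⟨(t, y), rfl⟩
  · rintro ⟨t, y⟩ ⟨t', y'⟩
    simp only [comp.mk_eq]
    refine ⟨hm.rel t y t' y', ?_⟩
    rintro ⟨q, c, rfl, rfl⟩
    exact (hm.balanced' q c t y).symm
  · rintro ⟨⟨g, h⟩, c⟩ ⟨t, y⟩
    refine ⟨(((g, (1 : Q)), c) • t, (((1 : Q), h), (1 : C)) • y), ?_, ?_⟩
    · simp only [hm.smul, mul_one]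
    · obtain ⟨h', e⟩ := comp.smul_mk ((g, h), c) (hm.isFree t y)
      exact e.symm

end IsComposite

/-- The `C`-fibred `(H × G)`-set obtained from a `C`-fibred `(G × H)`-set by exchanging the two
groups. -/
def swap (X : FibredSet C (G × H)) : FibredSet C (H × G) where
  carrier := X
  action := MulAction.compHom X
    ((MulEquiv.prodComm (M := H) (N := G)).toMonoidHom.prodMap (MonoidHom.id C))
  free := X.free

theorem IsComposite.swap {T : FibredSet C (G × Q)} {Y : FibredSet C (Q × H)}
    {X : FibredSet C (G × H)} {m : T → Y → X} (hm : IsComposite T Y X m) :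
    IsComposite Y.swap T.swap X.swap (fun y t => m t y) where
  smul h g c d y t := by
    have := hm.smul g h d c t y
    rw [mul_comm] at this
    exact this
  balanced q y t := hm.balanced q t y
  surjective x := by
    obtain ⟨t, y, h⟩ := hm.surjective x
    exact ⟨y, t, h⟩
  rel y t y' t' e := by
    obtain ⟨q, c, h1, h2⟩ := hm.rel t y t' y' e
    -- The twist by `c⁻¹` sits on the second factor, so exchanging the factors inverts `c`.
    refine ⟨q, c⁻¹, h2, ?_⟩
    rw [inv_inv]
    exact h1

/-- `X` is the composite of two fibred sets through the group `Q`. -/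
def FactorsThrough (X : FibredSet C (G × H)) (Q : Type u) [Group Q] : Prop :=
  ∃ (T : FibredSet C (G × Q)) (Y : FibredSet C (Q × H)) (m : T → Y → X), IsComposite T Y X m

theorem FactorsThrough.of_swap {X : FibredSet C (G × H)} (h : X.swap.FactorsThrough Q) :
    X.FactorsThrough Q := by
  obtain ⟨T, Y, m, hm⟩ := h
  exact ⟨_, _, _, hm.swap⟩

/-- The fibred subset of an invariant set of elements. -/
def restrict (X : FibredSet C G) (p : X → Prop) (hp : ∀ (a : G × C) x, p x → p (a • x)) :
    FibredSet C G where
  carrier := {x : X // p x}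
  action :=
    { smul := fun a x => ⟨a • x.1, hp a x.1 x.2⟩
      one_smul := fun x => Subtype.ext (one_smul _ x.1)
      mul_smul := fun a b x => Subtype.ext (mul_smul a b x.1) }
  free := fun c x h => X.free c x.1 (congrArg Subtype.val h)

/-- The fibred set obtained by letting a subgroup of the left group act on an invariant set of
elements. -/
def restrictLeft (X : FibredSet C (G × H)) (P : Subgroup G) (p : X → Prop)
    (hp : ∀ (a : (P × H) × C) x, p x → p ((((a.1.1 : G), a.1.2), a.2) • x)) :
    FibredSet C (P × H) where
  carrier := {x : X // p x}
  action :=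
    { smul := fun a x => ⟨(((a.1.1 : G), a.1.2), a.2) • x.1, hp a x.1 x.2⟩
      one_smul := fun x => Subtype.ext (one_smul ((G × H) × C) x.1)
      mul_smul := fun a b x => Subtype.ext
        (mul_smul (((a.1.1 : G), a.1.2), a.2) (((b.1.1 : G), b.1.2), b.2) x.1) }
  free := fun c x h => X.free c x.1 (congrArg Subtype.val h)

theorem restrictLeft_smul (X : FibredSet C (G × H)) (P : Subgroup G) (p : X → Prop)
    (hp : ∀ (a : (P × H) × C) x, p x → p ((((a.1.1 : G), a.1.2), a.2) • x))
    (a : (P × H) × C) (y : X.restrictLeft P p hp) :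
    (a • y).1 = (((a.1.1 : G), a.1.2), a.2) • y.1 := rfl

/-- Two representatives of a coset differ by an element of `N`, which acts trivially. This makes the
action through `Quotient.out` in `quotientLeft` multiplicative. -/
theorem out_smul (X : FibredSet C (G × H)) (N : Subgroup G)
    (hN : ∀ n ∈ N, ∀ x : X, ((n, (1 : H)), (1 : C)) • x = x) (g : G) (h : H) (c : C) (x : X) :
    (((g : G ⧸ N).out, h), c) • x = ((g, h), c) • x := by
  have hmem : g⁻¹ * (g : G ⧸ N).out ∈ N := by
    rw [← QuotientGroup.eq, QuotientGroup.out_eq']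
  have e : (((g : G ⧸ N).out, h), c) =
      ((g, h), c) * ((g⁻¹ * (g : G ⧸ N).out, (1 : H)), (1 : C)) := by
    simp
  rw [e, mul_smul, hN _ hmem]

/-- The fibred set for the quotient of the left group by a normal subgroup acting trivially. -/
noncomputable def quotientLeft (X : FibredSet C (G × H)) (N : Subgroup G) [N.Normal]
    (hN : ∀ n ∈ N, ∀ x : X, ((n, (1 : H)), (1 : C)) • x = x) : FibredSet C ((G ⧸ N) × H) where
  carrier := X
  action :=
    { smul := fun a x => ((a.1.1.out, a.1.2), a.2) • x
      one_smul := fun x => (X.out_smul N hN 1 1 1 x).trans (one_smul _ x)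
      mul_smul := fun a b x => by
        obtain ⟨⟨a, h⟩, c⟩ := a
        obtain ⟨⟨b, h'⟩, c'⟩ := b
        obtain ⟨a, rfl⟩ := QuotientGroup.mk_surjective a
        obtain ⟨b, rfl⟩ := QuotientGroup.mk_surjective b
        refine (X.out_smul N hN (a * b) (h * h') (c * c') x).trans ?_
        refine Eq.trans ?_ (X.out_smul N hN a h c _).symm
        refine Eq.trans ?_ (congrArg (((a, h), c) • ·) (X.out_smul N hN b h' c' x).symm)
        exact mul_smul ((a, h), c) ((b, h'), c') x }
  free := fun c x h => X.free c x ((X.out_smul N hN 1 1 c x).symm.trans h)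

/-! ### Induction and inflation, and what they force on stabilizers. -/

/-- The left projection of the stabilizer of `x`. -/
def leftProj (X : FibredSet C (G × H)) (x : X) : Subgroup G :=
  (MulAction.stabilizer ((G × H) × C) x).map
    ((MonoidHom.fst G H).comp (MonoidHom.fst (G × H) C))

theorem mem_leftProj {X : FibredSet C (G × H)} {x : X} {g : G} :
    g ∈ leftProj X x ↔ ∃ (h : H) (c : C), ((g, h), c) • x = x := by
  simp [leftProj, Subgroup.mem_map, MulAction.mem_stabilizer_iff]

/-- A transitive fibred set is induced from the left projection of a stabilizer. -/
theorem factorsThrough_leftProj [Finite C] [Finite G] (X : FibredSet C (G × H)) (x : X)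
    (hx : ∀ y : X, ∃ a : (G × H) × C, a • x = y) : X.FactorsThrough (leftProj X x) := by
  -- `Y` is the orbit of `x` under the smaller group, and `X` is recovered by inducing it to `G`:
  -- the left factor is `G × C`, with the projection acting on the right of `G`.
  let Y : FibredSet C (leftProj X x × H) := X.restrictLeft (leftProj X x)
    (fun y => ∃ a : (leftProj X x × H) × C, (((a.1.1 : G), a.1.2), a.2) • x = y) (by
      rintro a _ ⟨b, rfl⟩
      exact ⟨a * b, mul_smul (((a.1.1 : G), a.1.2), a.2) (((b.1.1 : G), b.1.2), b.2) x⟩)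
  have hY : ∀ (a : (leftProj X x × H) × C) (y : Y),
      (a • y).1 = (((a.1.1 : G), a.1.2), a.2) • y.1 := restrictLeft_smul X _ _ _
  refine ⟨ofHoms (MonoidHom.id G) (leftProj X x).subtype, Y,
    fun t y => ((t.1, (1 : H)), t.2) • y.1, ?_, ?_, ?_, ?_⟩
  · rintro g h c d ⟨a, e⟩ y
    rw [ofHoms_smul, hY]
    simp only [smul_smul, Prod.mk_mul_mk, MonoidHom.id_apply, map_one, inv_one, mul_one, one_mul,
      OneMemClass.coe_one]
    rw [mul_right_comm]
  · rintro p ⟨a, e⟩ y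
    rw [ofHoms_smul, hY]
    simp [smul_smul]
  · intro z
    obtain ⟨⟨⟨g, h⟩, c⟩, rfl⟩ := hx z
    refine ⟨(g, c), ⟨(((1 : G), h), (1 : C)) • x, ⟨((1, h), 1), rfl⟩⟩, ?_⟩
    simp [smul_smul]
  · rintro ⟨a, e⟩ ⟨_, ⟨⟨⟨p, h⟩, c⟩, rfl⟩⟩ ⟨a', e'⟩ ⟨_, ⟨⟨⟨p', h'⟩, c'⟩, rfl⟩⟩ E
    simp only [smul_smul, Prod.mk_mul_mk, one_mul] at E
    -- Two translates of `x` coincide, so their quotient stabilizes `x` and its `G`-component lies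
    -- in the projection. Removing `p` and `p'`, which lie there too, leaves `a'⁻¹ * a`.
    have E' := (inv_smul_eq_iff (g := ((a' * (p' : G), h'), e' * c'))).2 E
    rw [smul_smul] at E'
    have hmem : (a' * (p' : G))⁻¹ * (a * p) ∈ leftProj X x := mem_leftProj.2 ⟨_, _, E'⟩
    have hmem' : a'⁻¹ * a ∈ leftProj X x := by
      have := mul_mem (mul_mem p'.2 hmem) (inv_mem p.2)
      simpa [mul_assoc] using this
    -- The right action is by inverses, and `a * (a'⁻¹ * a)⁻¹ = a'`.
    refine ⟨⟨a'⁻¹ * a, hmem'⟩, e' * e⁻¹, ?_, ?_⟩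
    · rw [ofHoms_smul]
      simp only [Subgroup.subtype_apply, map_one, one_mul, mul_inv_rev, inv_inv,
        mul_inv_cancel_left, inv_mul_cancel_right]
      rfl
    · refine Subtype.ext ?_
      refine Eq.trans ?_ (hY ((⟨a'⁻¹ * a, hmem'⟩, 1), (e' * e⁻¹)⁻¹) _).symm
      refine MulAction.injective (((a', (1 : H)), e') : (G × H) × C) ?_
      simp only [smul_smul, Prod.mk_mul_mk, one_mul]
      rw [← E]
      have hc : e' * ((e' * e⁻¹)⁻¹ * c) = e * c := by
        rw [mul_inv_rev, inv_inv, mul_comm e, mul_assoc, mul_inv_cancel_left]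
      rw [hc]
      simp [mul_assoc]

/-- A fibred set on which a normal subgroup acts trivially is inflated from the quotient. -/
theorem factorsThrough_quotient [Finite C] [Finite G] (X : FibredSet C (G × H)) (N : Subgroup G)
    [N.Normal] (hN : ∀ n ∈ N, ∀ x : X, ((n, (1 : H)), (1 : C)) • x = x) :
    X.FactorsThrough (G ⧸ N) := by
  have hmk : ∀ (g : G) (h : H) (c : C) (y : X.quotientLeft N hN),
      (((g : G ⧸ N), h), c) • y =
        (show X.quotientLeft N hN from ((g, h), c) • (show X from y)) := X.out_smul N hN
  -- The left factor is the inflation set `(G ⧸ N) × C`, with `G` acting through the quotient map.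
  refine ⟨ofHoms (QuotientGroup.mk' N) (MonoidHom.id (G ⧸ N)), X.quotientLeft N hN,
    fun t y => (((t.1, (1 : H)), t.2) • y : X.quotientLeft N hN), ?_, ?_, ?_, ?_⟩
  · rintro g h c d ⟨a, e⟩ y
    rw [ofHoms_smul]
    refine Eq.trans ?_ (hmk g h (c * d) _)
    simp only [smul_smul]
    simp [mul_right_comm]
    rfl
  · rintro q ⟨a, e⟩ y
    rw [ofHoms_smul]
    simp [smul_smul]
    rfl
  · intro x
    exact ⟨(1, 1), x, one_smul (((G ⧸ N) × H) × C) (show X.quotientLeft N hN from x)⟩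
  · rintro ⟨a, e⟩ y ⟨a', e'⟩ y' E
    refine ⟨a'⁻¹ * a, e' * e⁻¹, ?_, ?_⟩
    · rw [ofHoms_smul]
      simp only [map_mul, map_inv, MonoidHom.id_apply, map_one, one_mul, mul_inv_rev, inv_inv,
        mul_inv_cancel_left, inv_mul_cancel_right]
      rfl
    · refine MulAction.injective (((a', (1 : H)), e') : ((G ⧸ N) × H) × C) ?_
      refine Eq.trans (Eq.symm E) ?_
      simp only [smul_smul]
      simp

/-- If a transitive fibred set does not factor through a smaller group, then stabilizers project
onto the left group. -/
theorem exists_smul_eq_of_not_factorsThrough [Finite C] [Finite G] (X : FibredSet C (G × H))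
    (hX : ∀ (Q : Type u) [Group Q] [Finite Q], Nat.card Q < Nat.card G → ¬ X.FactorsThrough Q)
    (x : X) (hx : ∀ y : X, ∃ a : (G × H) × C, a • x = y) (g : G) :
    ∃ (h : H) (c : C), ((g, h), c) • x = x := by
  rw [← mem_leftProj]
  by_contra hg
  refine hX (leftProj X x) ?_ (factorsThrough_leftProj X x hx)
  refine lt_of_le_of_ne (Subgroup.card_le_card_group _) fun e => hg ?_
  rw [Subgroup.eq_top_of_card_eq _ e]
  trivial

/-- If a transitive fibred set does not factor through a smaller group, then stabilizers meet the
left group trivially. -/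
theorem eq_one_of_not_factorsThrough [Finite C] [Finite G] (X : FibredSet C (G × H))
    (hX : ∀ (Q : Type u) [Group Q] [Finite Q], Nat.card Q < Nat.card G → ¬ X.FactorsThrough Q)
    (x : X) (hx : ∀ y : X, ∃ a : (G × H) × C, a • x = y) (g : G)
    (hg : ((g, (1 : H)), (1 : C)) • x = x) : g = 1 := by
  let N : Subgroup G := (MulAction.stabilizer ((G × H) × C) x).comap
    ((MonoidHom.inl (G × H) C).comp (MonoidHom.inl G H))
  have hmem : ∀ n, n ∈ N ↔ ((n, (1 : H)), (1 : C)) • x = x := fun n => Iff.rfl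
  -- Every `k : G` lifts to some `((k, h), c)` in the stabilizer, and conjugation by this lift acts
  -- on `G` as conjugation by `k`.
  have hN : N.Normal := by
    refine ⟨fun n hn k => ?_⟩
    rw [hmem] at hn ⊢
    obtain ⟨h, c, e⟩ := exists_smul_eq_of_not_factorsThrough X hX x hx k
    have e2 := inv_smul_eq_iff.2 e.symm
    have : ((k * n * k⁻¹, (1 : H)), (1 : C)) =
        ((k, h), c) * (((n, (1 : H)), (1 : C)) * ((k, h), c)⁻¹) := by
      simp [mul_assoc]
    rw [this, mul_smul, mul_smul, e2, hn, e]
  -- By transitivity the other stabilizers are conjugate to that of `x`, so the normal subgroup `N`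
  -- lies in all of them.
  have htriv : ∀ n ∈ N, ∀ y : X, ((n, (1 : H)), (1 : C)) • y = y := by
    intro n hn y
    obtain ⟨⟨⟨k, h⟩, c⟩, rfl⟩ := hx y
    have h2 := (hmem _).1 (hN.conj_mem n hn k⁻¹)
    have : (((n, (1 : H)), (1 : C)) * ((k, h), c)) =
        ((k, h), c) * ((k⁻¹ * n * k⁻¹⁻¹, (1 : H)), (1 : C)) := by
      simp [mul_assoc]
    rw [smul_smul, this, mul_smul, h2]
  by_contra h1
  refine hX (G ⧸ N) ?_ (factorsThrough_quotient X N htriv)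
  have h3 : 1 < Nat.card N := by
    rw [Subgroup.one_lt_card_iff_ne_bot]
    intro h
    exact h1 ((Subgroup.mem_bot).1 (h ▸ (hmem g).2 hg))
  rw [Subgroup.card_eq_card_quotient_mul_card_subgroup N]
  exact lt_mul_of_one_lt_right Nat.card_pos h3

end Factorization

end FibredSet

/-! ### Subgroups of a product of two groups and a group of prime order. -/

/-- A subgroup of `(G × H) × C`, with `C` of prime order and `|G| = |H|`, which projects onto `G` and
`H` and meets the three factors trivially, forces `G` and `H` to be isomorphic. -/
theorem nonempty_mulEquiv_of_subgroup_prod {C G H : Type*} [CommGroup C] [Group G] [Group H]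
    [Finite C] [Finite G] [Finite H] (hC : (Nat.card C).Prime) (hGH : Nat.card G = Nat.card H)
    (D : Subgroup ((G × H) × C)) (hfst : ∀ g, ∃ h c, ((g, h), c) ∈ D)
    (hsnd : ∀ h, ∃ g c, ((g, h), c) ∈ D) (hG : ∀ g, ((g, 1), 1) ∈ D → g = 1)
    (hH : ∀ h, ((1, h), 1) ∈ D → h = 1) : Nonempty (G ≃* H) := by
  let f : D →* G := ((MonoidHom.fst G H).comp (MonoidHom.fst (G × H) C)).comp D.subtype
  let g : D →* H := ((MonoidHom.snd G H).comp (MonoidHom.fst (G × H) C)).comp D.subtype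
  let χ : D →* C := (MonoidHom.snd (G × H) C).comp D.subtype
  have hf : Function.Surjective f := fun a => by
    obtain ⟨h, c, hm⟩ := hfst a
    exact ⟨⟨_, hm⟩, rfl⟩
  have hg : Function.Surjective g := fun a => by
    obtain ⟨h, c, hm⟩ := hsnd a
    exact ⟨⟨_, hm⟩, rfl⟩
  have key : ∀ {E : Type _} [Group E] [Finite E] (a : E →* G) (b : E →* H),
      Function.Bijective a → Function.Bijective b → Nonempty (G ≃* H) := fun a b ha hb =>
    ⟨(MulEquiv.ofBijective a ha).symm.trans (MulEquiv.ofBijective b hb)⟩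
  let χ' : f.ker →* C := χ.comp f.ker.subtype
  -- An element of `f.ker` with trivial `C`-component lies in `H`, hence is trivial.
  have hχ' : Function.Injective χ' := by
    rw [injective_iff_map_eq_one]
    rintro ⟨⟨⟨⟨a, b⟩, c⟩, hD⟩, ha⟩ hc
    change a = 1 at ha
    change c = 1 at hc
    subst ha hc
    obtain rfl := hH b hD
    rfl
  have hcard : Nat.card D = Nat.card f.ker * Nat.card G := by
    rw [← Subgroup.card_mul_index f.ker, Subgroup.index_ker, MonoidHom.range_eq_top.2 hf,
      Subgroup.card_top]
  have hdvd : Nat.card χ'.range = Nat.card f.ker :=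
    (Nat.card_congr (MonoidHom.ofInjective hχ').toEquiv).symm
  rcases (Nat.dvd_prime hC).1 (hdvd ▸ Subgroup.card_subgroup_dvd_card χ'.range) with h1 | hp
  · rw [h1, one_mul] at hcard
    exact key f g ((Nat.bijective_iff_surjective_and_card f).2 ⟨hf, hcard⟩)
      ((Nat.bijective_iff_surjective_and_card g).2 ⟨hg, hcard.trans hGH⟩)
  -- Now `f.ker` already maps onto `C`, so `χ` is surjective and `χ.ker` has order `|D| / |C| =
  -- |G|`. Trivial intersection with `H` and `G` makes its maps to `G` and `H` injective, hence
  -- bijective.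
  · have hle : χ'.range ≤ χ.range := by
      rintro _ ⟨a, rfl⟩
      exact ⟨a, rfl⟩
    have htop : χ.range = ⊤ := by
      rw [eq_top_iff, ← Subgroup.eq_top_of_card_eq χ'.range (hdvd.trans hp)]
      exact hle
    have hV : Nat.card χ.ker = Nat.card G := by
      have h := Subgroup.card_mul_index χ.ker
      rw [Subgroup.index_ker, htop, Subgroup.card_top, hcard, hp, mul_comm] at h
      exact Nat.eq_of_mul_eq_mul_left hC.pos h
    refine key (f.comp χ.ker.subtype) (g.comp χ.ker.subtype)
      ((Nat.bijective_iff_injective_and_card _).2 ⟨?_, hV⟩)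
      ((Nat.bijective_iff_injective_and_card _).2 ⟨?_, hV.trans hGH⟩)
    · rw [injective_iff_map_eq_one]
      rintro ⟨⟨⟨⟨a, b⟩, c⟩, hD⟩, hc⟩ ha
      change a = 1 at ha
      change c = 1 at hc
      subst ha hc
      obtain rfl := hH b hD
      rfl
    · rw [injective_iff_map_eq_one]
      rintro ⟨⟨⟨⟨a, b⟩, c⟩, hD⟩, hc⟩ hb
      change b = 1 at hb
      change c = 1 at hc
      subst hb hc
      obtain rfl := hG a hD
      rfl

/-! ### Reduction to transitive fibred sets. -/

namespace FibredSet

section Orbits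

variable {C G : Type u} [CommGroup C] [Group G]

theorem restrict_sum_restrict_not (X : FibredSet C G) (p : X → Prop)
    (hp : ∀ (a : G × C) x, p x → p (a • x)) (hp' : ∀ (a : G × C) x, ¬ p x → ¬ p (a • x)) :
    Iso ((X.restrict p hp).sum (X.restrict (fun x => ¬ p x) hp')) X :=
  Iso.of_sum (fun x => x.1) (fun x => x.1) Subtype.val_injective Subtype.val_injective
    (fun x y h => y.2 (h ▸ x.2))
    (fun z => (em (p z)).imp (fun h => ⟨⟨z, h⟩, rfl⟩) (fun h => ⟨⟨z, h⟩, rfl⟩))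
    (fun _ _ => rfl) (fun _ _ => rfl)

theorem sum_self_iso_of_isEmpty (X : FibredSet C G) [IsEmpty X] : Iso (X.sum X) X :=
  Iso.of_sum id id Function.injective_id Function.injective_id (fun x => isEmptyElim x)
    (fun z => isEmptyElim z) (fun _ _ => rfl) (fun _ _ => rfl)

end Orbits

end FibredSet

namespace MonomialBurnside

variable {R : Type v} {C G : Type u} [CommRing R] [CommGroup C] [Group G]

/-- A linear map that does not vanish on the monomial Burnside module does not vanish on the class
of some transitive fibred set. -/
theorem exists_transitive_ne_zero {M : Type*} [AddCommGroup M] [Module R M]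
    (φ : MonomialBurnside R C G →ₗ[R] M) (hφ : φ ≠ 0) :
    ∃ (X : FibredSet C G) (x : X), φ (cls R X) ≠ 0 ∧ ∀ y : X, ∃ a : G × C, a • x = y := by
  have hex : ∃ X : FibredSet C G, φ (cls R X) ≠ 0 := by
    by_contra! h
    exact hφ (hom_ext h)
  -- A set of least cardinality is transitive: otherwise an orbit and its complement are both
  -- smaller, so `φ` kills both classes and therefore their sum.
  obtain ⟨X, hX, hmin⟩ := exists_minimalFor_of_wellFoundedLT
    (fun X : FibredSet C G => φ (cls R X) ≠ 0) (fun X => Nat.card X) hex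
  have hzero : ∀ Y : FibredSet C G, Nat.card Y < Nat.card X → φ (cls R Y) = 0 := by
    intro Y hY
    by_contra h
    exact absurd (hmin h hY.le) (not_le.2 hY)
  have hne : Nonempty X := by
    by_contra h
    rw [not_nonempty_iff] at h
    -- For empty `X` this gives `[X] + [X] = [X]`, so the class is zero.
    have e := cls_eq_of_iso R X.sum_self_iso_of_isEmpty
    rw [cls_sum, add_eq_left] at e
    rw [e, map_zero] at hX
    exact hX rfl
  obtain ⟨x⟩ := hne
  refine ⟨X, x, hX, fun y => ?_⟩
  by_contra hy
  let p : X → Prop := fun z => ∃ a : G × C, a • x = z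
  have hp : ∀ (a : G × C) z, p z → p (a • z) := by
    rintro a _ ⟨b, rfl⟩
    exact ⟨a * b, mul_smul _ _ _⟩
  have hp' : ∀ (a : G × C) z, ¬ p z → ¬ p (a • z) := by
    intro a z hz h
    have := hp a⁻¹ _ h
    rw [inv_smul_smul] at this
    exact hz this
  have e := cls_eq_of_iso R (X.restrict_sum_restrict_not p hp hp')
  rw [cls_sum] at e
  refine hX ?_
  rw [← e, map_add, hzero (X.restrict p hp) (Finite.card_subtype_lt (x := y) hy),
    hzero (X.restrict _ hp') (Finite.card_subtype_lt (x := x) fun h => h ⟨1, one_smul _ x⟩),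
    add_zero]

end MonomialBurnside

/-! ### Simple functors are generated by each nonzero value. -/

namespace CategoryTheory

variable {R : Type v} [CommRing R] {𝒞 : Type*} [Category 𝒞]

/-- The subfunctor of a functor to modules generated by its value at `H`. -/
noncomputable def subfunctorGeneratedAt (S : 𝒞 ⥤ ModuleCat.{w} R) (H : 𝒞) :
    𝒞 ⥤ ModuleCat.{w} R where
  obj G := ModuleCat.of R
    (Submodule.span R {x : S.obj G | ∃ (f : H ⟶ G) (y : S.obj H), S.map f y = x})
  map {G G'} g := ModuleCat.ofHom ((S.map g).hom.restrict (by
    intro x hx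
    induction hx using Submodule.span_induction with
    | mem x h =>
      obtain ⟨f, y, rfl⟩ := h
      exact Submodule.subset_span ⟨f ≫ g, y, by rw [S.map_comp]; rfl⟩
    | zero => simp
    | add x y _ _ h1 h2 => rw [map_add]; exact add_mem h1 h2
    | smul r x _ h => rw [map_smul]; exact Submodule.smul_mem _ r h))
  map_id G :=
    ModuleCat.hom_ext (LinearMap.ext fun x =>
      Subtype.ext (congrArg (fun t => t.hom x.1) (S.map_id G)))
  map_comp f g :=
    ModuleCat.hom_ext (LinearMap.ext fun x =>
      Subtype.ext (congrArg (fun t => t.hom x.1) (S.map_comp f g)))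

/-- The inclusion of the subfunctor generated by the value at `H`. -/
noncomputable def subfunctorGeneratedAtι (S : 𝒞 ⥤ ModuleCat.{w} R) (H : 𝒞) :
    subfunctorGeneratedAt S H ⟶ S where
  app _ := ModuleCat.ofHom (Submodule.subtype _)
  naturality _ _ _ := rfl

/-- The inclusion of the generated subfunctor is a monomorphism, nonzero because the identity of `H`
puts all of `S.obj H` in its image. Simplicity makes it an isomorphism. -/
theorem mem_span_of_simple (S : 𝒞 ⥤ ModuleCat.{w} R) [Simple S] (H : 𝒞)
    [Nontrivial (S.obj H)] {G : 𝒞} (x : S.obj G) :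
    x ∈ Submodule.span R {x : S.obj G | ∃ (f : H ⟶ G) (y : S.obj H), S.map f y = x} := by
  have hmono : ∀ G', Mono ((subfunctorGeneratedAtι S H).app G') := fun _ =>
    (ModuleCat.mono_iff_injective _).2 Subtype.val_injective
  have : Mono (subfunctorGeneratedAtι S H) := NatTrans.mono_of_mono_app _
  have hne : subfunctorGeneratedAtι S H ≠ 0 := by
    intro h
    obtain ⟨y, hy⟩ := exists_ne (0 : S.obj H)
    have hy' : y ∈ Submodule.span R {x : S.obj H | ∃ (f : H ⟶ H) (y : S.obj H), S.map f y = x} :=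
      Submodule.subset_span ⟨𝟙 H, y, by simp⟩
    have := congrArg (fun t => (t.app H).hom ⟨y, hy'⟩) h
    exact hy this
  have := isIso_of_mono_of_nonzero hne
  have hiso : IsIso ((subfunctorGeneratedAtι S H).app G) := inferInstance
  have hepi : Function.Surjective ((subfunctorGeneratedAtι S H).app G) :=
    (ModuleCat.epi_iff_surjective _).1 inferInstance
  obtain ⟨z, rfl⟩ := hepi x
  exact z.2

/-- A simple functor to modules which is nonzero at `H` and `K` does not kill all morphisms from
`H` to `K`. -/
theorem exists_map_ne_zero_of_simple (S : 𝒞 ⥤ ModuleCat.{w} R) [Simple S] (H K : 𝒞)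
    [Nontrivial (S.obj H)] [Nontrivial (S.obj K)] : ∃ f : H ⟶ K, S.map f ≠ 0 := by
  by_contra! h
  obtain ⟨x, hx⟩ := exists_ne (0 : S.obj K)
  refine hx ?_
  have hmem := mem_span_of_simple S H x
  have hspan : Submodule.span R {x : S.obj K | ∃ (f : H ⟶ K) (y : S.obj H), S.map f y = x} = ⊥ := by
    rw [Submodule.span_eq_bot]
    rintro _ ⟨f, y, rfl⟩
    rw [h f]
    rfl
  rwa [hspan, Submodule.mem_bot] at hmem

end CategoryTheory

/-! ### Vanishing on composites, and the theorem. -/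

namespace FibredBisetCat

variable {R : Type v} {C : Type u} [CommRing R] [CommGroup C] [Finite C]

/-- A functor kills the class of a fibred set that factors through a group where it vanishes. -/
theorem map_cls_eq_zero (S : FibredBisetCat R C ⥤ ModuleCat.{w} R) {H K : FibredBisetCat R C}
    (Q : FibredBisetCat R C) [Subsingleton (S.obj Q)]
    (X : FibredSet C (K.carrier × H.carrier)) (hX : X.FactorsThrough Q.carrier) :
    S.map (show H ⟶ K from MonomialBurnside.cls R X) = 0 := by
  obtain ⟨T, Y, m, hm⟩ := hX
  have e : (show H ⟶ K from MonomialBurnside.cls R X) =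
      (show H ⟶ Q from MonomialBurnside.cls R Y) ≫ (show Q ⟶ K from MonomialBurnside.cls R T) :=
    (MonomialBurnside.cls_eq_of_iso R hm.iso).trans (MonomialBurnside.comp_cls R T Y).symm
  rw [e, S.map_comp]
  have hz : Limits.IsZero (S.obj Q) := ModuleCat.isZero_of_subsingleton _
  rw [hz.eq_zero_of_tgt (S.map _), Limits.zero_comp]

end FibredBisetCat

theorem corollary2p3 {R : Type v} [CommRing R] {C : Type u} [CommGroup C] [Finite C]
    (hC : (Nat.card C).Prime)
    (S : FibredBisetCat R C ⥤ ModuleCat.{w} R) [S.Additive] [S.Linear R] [Simple S]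
    (H K : FibredBisetCat R C)
    (hH : FibredBisetCat.IsMinimalGroup S H) (hK : FibredBisetCat.IsMinimalGroup S K) :
    Nonempty (H.carrier ≃* K.carrier) := by
  obtain ⟨hH1, hH2⟩ := hH
  obtain ⟨hK1, hK2⟩ := hK
  have hcard : Nat.card K.carrier = Nat.card H.carrier := by
    refine le_antisymm (le_of_not_gt fun h => ?_) (le_of_not_gt fun h => ?_)
    · exact not_subsingleton _ (hK2 H h)
    · exact not_subsingleton _ (hH2 K h)
  obtain ⟨f, hf⟩ := exists_map_ne_zero_of_simple S H K
  -- Linearity of `S` on morphisms is what allows `f` to be replaced by the class of a transitive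
  -- set.
  have hφ : S.mapLinearMap R (X := H) (Y := K) ≠ 0 := fun h => hf (LinearMap.congr_fun h f)
  obtain ⟨X, x, hX, hx⟩ := MonomialBurnside.exists_transitive_ne_zero
    (G := K.carrier × H.carrier) (S.mapLinearMap R (X := H) (Y := K)) hφ
  have hfac : ∀ (Q : Type u) [Group Q] [Finite Q], Nat.card Q < Nat.card K.carrier →
      ¬ X.FactorsThrough Q := by
    intro Q _ _ hQ h
    have : Subsingleton (S.obj (⟨Q⟩ : FibredBisetCat R C)) := hK2 ⟨Q⟩ hQ
    exact hX (FibredBisetCat.map_cls_eq_zero S (⟨Q⟩ : FibredBisetCat R C) X h)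
  have hfac' : ∀ (Q : Type u) [Group Q] [Finite Q], Nat.card Q < Nat.card H.carrier →
      ¬ X.swap.FactorsThrough Q := fun Q _ _ hQ h => hfac Q (hcard ▸ hQ) h.of_swap
  have hx' : ∀ y : X.swap, ∃ a : (H.carrier × K.carrier) × C,
      a • (show X.swap from x) = y := by
    intro y
    obtain ⟨⟨⟨k, h⟩, c⟩, e⟩ := hx y
    exact ⟨((h, k), c), e⟩
  -- The stabilizer of `x` in `X.swap` is, by definition, the same subgroup with the coordinates
  -- exchanged, so the two statements about `X.swap` give the conditions on the `H` side.
  obtain ⟨e⟩ := nonempty_mulEquiv_of_subgroup_prod hC hcard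
    (MulAction.stabilizer ((K.carrier × H.carrier) × C) x)
    (X.exists_smul_eq_of_not_factorsThrough hfac x hx)
    (X.swap.exists_smul_eq_of_not_factorsThrough hfac' x hx')
    (X.eq_one_of_not_factorsThrough hfac x hx)
    (X.swap.eq_one_of_not_factorsThrough hfac' x hx')
  exact ⟨e.symm⟩
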